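/- Conventions. All objects are simplicial sets. An edge $e$ of $X$ is cocartesian for $p\colon X\to S$ if every lifting problem of an outer horn $\Lambda^n_0\subset\Delta^n$, $n\ge 2$, against $p$ whose edge $0\to 1$ is sent to $e$ has a solution; cartesian edges are defined dually with $\Lambda^n_n$ and the edge $n-1\to n$. An inner fibration $p$ is a cocartesian (cartesian) fibration if each edge of the base has a cocartesian (cartesian) lift with any prescribed lift of its source (target), and a bicartesian fibration if it is both. Let $\mathcal C,\mathcal D$ be quasicategories, $f\colon\mathcal C\to\mathcal D$ and $g\colon\mathcal D\to\mathcal C$ functors, and $p\colon\mathcal M\to\Delta^1$ a bicartesian fibration associated to $f$ and $g$ via the following data: isomorphisms $h_0\colon\mathcal C\cong\mathcal M_0$ and $h_1\colon\mathcal D\cong\mathcal M_1$ onto the fibers of $p$, and maps $u\colon\mathcal C\times\Delta^1\to\mathcal M$ and $v\colon\mathcal D\times\Delta^1\to\mathcal M$ over $\Delta^1$ such that $u|_{\mathcal C\times\{0\}}=h_0$, $u|_{\mathcal C\times\{1\}}=h_1\circ f$, $v|_{\mathcal D\times\{0\}}=h_0\circ g$, $v|_{\mathcal D\times\{1\}}=h_1$,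 for every vertex $c$ of $\mathcal C$ the edge $u|_{\{c\}\times\Delta^1}$ is $p$-cocartesian, and for every vertex $d$ of $\mathcal D$ the edge $v|_{\{d\}\times\Delta^1}$ is $p$-cartesian. For a map $s\colon L\to\Delta^1$ with fibers $L_0,L_1$, say that $\alpha\colon L\to\mathcal C$ and $\beta\colon L\to\mathcal D$ are adjunct relative to $s$ if there is a map $A\colon L\times\Delta^1\to\mathcal M$ with $p\circ A=\mathrm{pr}_{\Delta^1}$, $A|_{L\times\{0\}}=h_0\circ\alpha$, $A|_{L\times\{1\}}=h_1\circ\beta$, $A|_{L_0\times\Delta^1}=u\circ(\alpha|_{L_0}\times\mathrm{id})$ and $A|_{L_1\times\Delta^1}=v\circ(\beta|_{L_1}\times\mathrm{id})$. Proposition. Let $s\colon K\to\Delta^1$ be a map of simplicial sets and let $i\colon K'\hookrightarrow K$ be a monomorphism which induces an isomorphism $K'_1\to K_1$ between the fibers of $s\circ i$ and $s$ over $1$. Let $\alpha\colon K\to\mathcal C$ and $\tilde\alpha'\colon K'\to\mathcal D$ be maps such that $\tilde\alpha'$ is adjunct to $\alpha\circ i$ relative to $s\circ i$. Then there exists $\tilde\alpha\colon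 K\to\mathcal D$ with $\tilde\alpha\circ i=\tilde\alpha'$ such that $\tilde\alpha$ is adjunct to $\alpha$ relative to $s$. Furthermore, any two such $\tilde\alpha$ are equivalent as functors $K\to\mathcal D$, i.e. there is an edge between them in the simplicial set $\operatorname{Fun}(K,\mathcal D)$ which is an equivalence (invertible up to homotopy). -/

import Mathlib

open CategoryTheory MonoidalCategory CartesianMonoidalCategory Simplicial SSet

universe u

/-- An edge `e` of `X` is `p`-cocartesian if every lifting problem of an outer horn `Λ[n, 0]`, `n ≥ 2`,
against `p`, in which the edge `0 → 1` of the horn is sent to `e`, has a solution. -/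
def IsCocartesianEdge {X S : SSet.{u}} (p : X ⟶ S) (e : X _⦋1⦌) : Prop :=
  ∀ (n : ℕ) (σ : (Λ[n + 2, 0] : SSet.{u}) ⟶ X) (τ : Δ[n + 2] ⟶ S),
    σ.app _ (horn.edge (n + 2) 0 0 1 (Fin.zero_le _)
      (by rw [Finset.insert_idem]; exact Finset.card_le_two.trans (by omega))) = e →
    σ ≫ p = Λ[n + 2, 0].ι ≫ τ →
    ∃ l : Δ[n + 2] ⟶ X, Λ[n + 2, 0].ι ≫ l = σ ∧ l ≫ p = τ

/-- An edge `e` of `X` is `p`-cartesian if every lifting problem of an outer horn `Λ[n, n]`, `n ≥ 2`,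
against `p`, in which the edge `n - 1 → n` of the horn is sent to `e`, has a solution. -/
def IsCartesianEdge {X S : SSet.{u}} (p : X ⟶ S) (e : X _⦋1⦌) : Prop :=
  ∀ (n : ℕ) (σ : (Λ[n + 2, Fin.last (n + 2)] : SSet.{u}) ⟶ X) (τ : Δ[n + 2] ⟶ S),
    σ.app _ (horn.edge (n + 2) (Fin.last (n + 2)) (Fin.last (n + 1)).castSucc (Fin.last (n + 2))
      (Fin.le_last _)
      (by rw [Finset.insert_eq_of_mem (by simp)]; exact Finset.card_le_two.trans (by omega))) = e →
    σ ≫ p = Λ[n + 2, Fin.last (n + 2)].ι ≫ τ →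
    ∃ l : Δ[n + 2] ⟶ X, Λ[n + 2, Fin.last (n + 2)].ι ≫ l = σ ∧ l ≫ p = τ

/-- A cocartesian fibration: an inner fibration such that every edge `e` of the base has a
cocartesian lift starting at any given lift of the source of `e`. -/
structure IsCocartesianFibration {X S : SSet.{u}} (p : X ⟶ S) : Prop where
  inner : InnerFibration p
  exists_lift : ∀ (x : X _⦋0⦌) (e : S _⦋1⦌), S.δ 1 e = p.app _ x →
    ∃ e' : X _⦋1⦌, X.δ 1 e' = x ∧ p.app _ e' = e ∧ IsCocartesianEdge p e'

/-- A cartesian fibration: an inner fibration such that every edge `e` of the base has a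
cartesian lift ending at any given lift of the target of `e`. -/
structure IsCartesianFibration {X S : SSet.{u}} (p : X ⟶ S) : Prop where
  inner : InnerFibration p
  exists_lift : ∀ (y : X _⦋0⦌) (e : S _⦋1⦌), S.δ 0 e = p.app _ y →
    ∃ e' : X _⦋1⦌, X.δ 0 e' = y ∧ p.app _ e' = e ∧ IsCartesianEdge p e'

/-- A bicartesian fibration is both a cocartesian and a cartesian fibration. -/
structure IsBicartesianFibration {X S : SSet.{u}} (p : X ⟶ S) : Prop where
  cocartesian : IsCocartesianFibration p
  cartesian : IsCartesianFibration p

/-- The fiber of `s : K ⟶ Δ[1]` over the vertex `j`, as a subcomplex of `K`. -/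
def fiber {K : SSet.{u}} (s : K ⟶ Δ[1]) (j : Fin 2) : K.Subcomplex :=
  (stdSimplex.face {j}).preimage s

/-- The map induced on the fibers over `j` by a map `i : K' ⟶ K` over `Δ[1]`. -/
def fiberMap {K' K : SSet.{u}} (i : K' ⟶ K) (s : K ⟶ Δ[1]) (j : Fin 2) :
    (fiber (i ≫ s) j : SSet.{u}) ⟶ (fiber s j : SSet.{u}) :=
  Subcomplex.lift ((fiber (i ≫ s) j).ι ≫ i) (by rintro m _ ⟨x, rfl⟩; exact x.2)

/-- The edge `u|{c} × Δ¹` of `M`, for `u : C × Δ¹ ⟶ M` and a vertex `c` of `C`. -/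
def edgeAt {C M : SSet.{u}} (u : C ⊗ Δ[1] ⟶ M) (c : C _⦋0⦌) : M _⦋1⦌ :=
  SSet.yonedaEquiv (lift (SSet.const c) (𝟙 (Δ[1] : SSet.{u})) ≫ u)

/-- Data `(h₀, h₁, u, v)` exhibiting `p : M ⟶ Δ[1]` as associated to the functors `f : C ⟶ D` and
`g : D ⟶ C`. The data are chosen such that `h₀` and `h₁` are isomorphisms onto the fibers of `p`. -/
structure AssociatedData {M C D : SSet.{u}} (p : M ⟶ Δ[1]) (f : C ⟶ D) (g : D ⟶ C) where
  h₀ : C ≅ (fiber p 0 : SSet.{u})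
  h₁ : D ≅ (fiber p 1 : SSet.{u})
  u : C ⊗ Δ[1] ⟶ M
  v : D ⊗ Δ[1] ⟶ M
  u_p : u ≫ p = snd C Δ[1]
  v_p : v ≫ p = snd D Δ[1]
  u_zero : ι₀ ≫ u = h₀.hom ≫ (fiber p 0).ι
  u_one : ι₁ ≫ u = f ≫ h₁.hom ≫ (fiber p 1).ι
  u_cocartesian : ∀ c : C _⦋0⦌, IsCocartesianEdge p (edgeAt u c)
  v_zero : ι₀ ≫ v = g ≫ h₀.hom ≫ (fiber p 0).ι
  v_one : ι₁ ≫ v = h₁.hom ≫ (fiber p 1).ι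
  v_cartesian : ∀ d : D _⦋0⦌, IsCartesianEdge p (edgeAt v d)

/-- `α : K ⟶ C` and `α' : K ⟶ D` are adjunct relative to `s : K ⟶ Δ[1]`. -/
def IsAdjunct {M C D : SSet.{u}} {p : M ⟶ Δ[1]} {f : C ⟶ D} {g : D ⟶ C}
    (d : AssociatedData p f g) {K : SSet.{u}} (s : K ⟶ Δ[1]) (α : K ⟶ C) (α' : K ⟶ D) : Prop :=
  ∃ A : K ⊗ Δ[1] ⟶ M,
    A ≫ p = snd K Δ[1] ∧
    ι₀ ≫ A = α ≫ d.h₀.hom ≫ (fiber p 0).ι ∧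
    ι₁ ≫ A = α' ≫ d.h₁.hom ≫ (fiber p 1).ι ∧
    (fiber s 0).ι ▷ Δ[1] ≫ A = ((fiber s 0).ι ≫ α) ▷ Δ[1] ≫ d.u ∧
    (fiber s 1).ι ▷ Δ[1] ≫ A = ((fiber s 1).ι ≫ α') ▷ Δ[1] ≫ d.v

/-- The vertex of the simplicial set `Fun(K, D)` given by a map `φ : K ⟶ D`. -/
noncomputable def funVertex {K D : SSet.{u}} (φ : K ⟶ D) : ((ihom K).obj D) _⦋0⦌ :=
  unitHomEquiv _ (MonoidalClosed.curry ((ρ_ K).hom ≫ φ))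

/-- Two functors `φ ψ : K ⟶ D` are equivalent if some edge `φ → ψ` of `Fun(K, D)` is an
equivalence, that is, has an inverse up to homotopy. -/
def FunctorsEquivalent {K D : SSet.{u}} (φ ψ : K ⟶ D) : Prop :=
  ∃ e : Edge (funVertex φ) (funVertex ψ), Nonempty e.InvStruct

/-!
Put `cyl L = K × {0} ∪ L × Δ¹ ⊆ K × Δ¹` for a subcomplex `L` of `K`. Everything follows from one
relative extension property (`SSet.exists_extension_of_isCocartesianEdge`): if `p` is an inner
fibration and `L` contains all vertices of `K`, then a lift along `p` defined on `cyl L` extends to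
`K × Δ¹`, provided that, for each simplex of `K` outside `L`, the lift sends the edge `{c} × Δ¹` at
its initial vertex `c` to a cocartesian edge. By Zorn's lemma and induction on the dimension it
suffices to extend over a single cell, from `Δⁿ × {0} ∪ ∂Δⁿ × Δ¹` to `Δⁿ × Δ¹` with `n ≥ 1`
(`SSet.prism.exists_extension`). One attaches the `(n + 1)`-simplices
`(0, 0), …, (k, 0), (k, 1), …, (n, 1)` for `k = n, …, 0`, each along its `k`-th horn. These
horns are inner for `k > 0`, and for `k = 0` the horn is outer, with initial edge `{0} × Δ¹`.

A simplex of `K` outside the two fibers of `s` starts over the vertex `0`, and there the map `u` has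
cocartesian edges. So the property applies as soon as `L` contains both fibers and the lift is given
by `u` over the fiber at `0` (`AssociatedData.exists_extension`).

* Existence: take `L` to be the union of `K'` and of the fiber over `0`; it contains the fiber over
  `1` by assumption. The end `K × {1}` of the extended lift is the required map to `D`.
* Uniqueness: let `J` be the nerve of the walking isomorphism. Two solutions agree on the fiber over
  `1`, so their adjunction maps agree over both fibers of `s` and on `K × {0}`, whether or not they
  agree over `K'`. They therefore define a lift on `cyl L` for the subcomplex `L` of `K × J` which
  is the union of `K × ∂J`, where `∂J` consists of the two vertices of `J`, and of the product of
  the two fibers with `J`. Its extension gives a map `K × J ⟶ D` between the two solutions, that is,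
  a map `J ⟶ Fun(K, D)`, and the image of the isomorphism of `J` is an equivalence.
-/

open Opposite

/-! ### Gluing maps of simplicial sets -/

namespace SSet

lemma congr_app_apply {X Y : SSet.{u}} {f g : X ⟶ Y} (h : f = g) {m} (x : X.obj m) :
    f.app m x = g.app m x := by
  rw [h]

/-- Descent along a jointly surjective family of maps `σ i : Y i ⟶ X`: maps `ψ i` which agree
wherever the `σ i` do come from a map out of `X`. All gluing below is done with this lemma. -/
lemma exists_desc {ι : Type*} {Y : ι → SSet.{u}} {X M : SSet.{u}}
    (σ : ∀ i, Y i ⟶ X) (ψ : ∀ i, Y i ⟶ M)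
    (hσ : ∀ (n : SimplexCategoryᵒᵖ) (x : X.obj n), ∃ i y, (σ i).app n y = x)
    (hψ : ∀ (n : SimplexCategoryᵒᵖ) (i j) (y : (Y i).obj n) (z : (Y j).obj n),
      (σ i).app n y = (σ j).app n z → (ψ i).app n y = (ψ j).app n z) :
    ∃ φ : X ⟶ M, ∀ i n (y : (Y i).obj n), φ.app n ((σ i).app n y) = (ψ i).app n y := by
  choose c y hy using hσ
  have key : ∀ n i (z : (Y i).obj n),
      (ψ (c n ((σ i).app n z))).app n (y n ((σ i).app n z)) = (ψ i).app n z :=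
    fun n i z ↦ hψ _ _ _ _ _ (hy _ _)
  refine ⟨{ app := fun n ↦ ↾fun x ↦ (ψ (c n x)).app n (y n x), naturality := ?_ }, ?_⟩
  · intro m n f
    ext x
    have h := key n (c m x) ((Y _).map f (y m x))
    rw [NatTrans.naturality_apply, NatTrans.naturality_apply, hy] at h
    exact h
  · exact fun i n z ↦ key n i z

end SSet

/-! ### The filtration of `Δ[n] ⊗ Δ[1]` by prisms -/

namespace SSet

/-- The edge `{c} × Δ¹` of `X ⊗ Δ[1]` at a vertex `c` of `X`. -/
def verticalEdge {X : SSet.{u}} (c : X _⦋0⦌) : (X ⊗ Δ[1] : SSet.{u}) _⦋1⦌ :=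
  (X.σ 0 c, yonedaEquiv (𝟙 _))

lemma whiskerRight_app_verticalEdge {X Y : SSet.{u}} (f : X ⟶ Y) (c : X _⦋0⦌) :
    (f ▷ Δ[1]).app _ (verticalEdge c) = verticalEdge (f.app _ c) :=
  Prod.ext (σ_naturality_apply f 0 c) rfl

lemma edgeAt_eq {C M : SSet.{u}} (u : C ⊗ Δ[1] ⟶ M) (c : C _⦋0⦌) :
    edgeAt u c = u.app _ (verticalEdge c) := by
  refine congr_arg (u.app _) (Prod.ext ?_ rfl)
  refine congr_arg (fun f : ⦋1⦌ ⟶ ⦋0⦌ ↦ C.map f.op c) ?_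
  ext i : 3
  exact Subsingleton.elim (α := Fin 1) _ _

namespace prism

/-- The simplices of `Δ[n] ⊗ Δ[1]` whose first component misses a vertex of `Δ[n]`, or all of
whose vertices `(a, 1)` satisfy `j ≤ a`. In other words, this is the union of
`∂Δ[n] ⊗ Δ[1]`, `Δ[n] ⊗ {0}` and of the `(n + 1)`-simplices `prism.simplex k` for `j ≤ k`. -/
def stage (n j : ℕ) : (Δ[n] ⊗ Δ[1] : SSet.{u}).Subcomplex where
  obj m := {x | x.1 ∈ (boundary n).obj m ∨
    ∀ i, stdSimplex.asOrderHom x.2 i = 1 → j ≤ (stdSimplex.asOrderHom x.1 i : ℕ)}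
  map f _ hx := hx.imp ((boundary n).map f ·) (fun h _ hi ↦ h _ hi)

lemma mem_stage_iff {n j m : ℕ} (x : (Δ[n] ⊗ Δ[1] : SSet.{u}) _⦋m⦌) :
    x ∈ (stage n j).obj _ ↔ (¬ Function.Surjective (x.1 : Fin (m + 1) → Fin (n + 1))) ∨
      ∀ i : Fin (m + 1), x.2 i = 1 → j ≤ (x.1 i : ℕ) := Iff.rfl

lemma stage_zero (n : ℕ) : stage.{u} n 0 = ⊤ := by
  ext m x
  exact iff_of_true (Or.inr fun _ _ ↦ Nat.zero_le _) trivial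

lemma stage_last (n : ℕ) : stage.{u} n (n + 1) =
    (boundary n).unionProd (stdSimplex.face {0}) := by
  ext ⟨m⟩ x
  induction m using SimplexCategory.rec with | _ m
  refine (mem_stage_iff x).trans (Iff.trans ?_ (Subcomplex.mem_unionProd_iff _ _ x).symm)
  rw [stdSimplex.mem_face_iff, or_comm]
  refine or_congr (forall_congr' fun i ↦ ?_) Iff.rfl
  have := (x.1 i).isLt
  have := x.2 i
  simp only [Finset.mem_singleton]
  constructor
  · intro h
    by_contra h'
    have := h (Fin.eq_one_of_ne_zero _ h')
    omega
  · intro h h'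
    simp [h] at h'

/-- The `(n + 1)`-simplex `(0, 0), …, (k, 0), (k, 1), …, (n, 1)` of `Δ[n] ⊗ Δ[1]`, as a map. -/
noncomputable def simplex {n : ℕ} (k : Fin (n + 1)) : Δ[n + 1] ⟶ (Δ[n] ⊗ Δ[1] : SSet.{u}) :=
  lift (SSet.stdSimplex.map (SimplexCategory.σ k))
    (yonedaEquiv.symm (stdSimplex.objMk₁ k.succ.castSucc))

lemma simplex_fst {n m : ℕ} (k : Fin (n + 1)) (x : (Δ[n + 1] : SSet.{u}) _⦋m⦌)
    (i : Fin (m + 1)) : ((simplex k).app _ x).1 i = k.predAbove (x i) := rfl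

lemma simplex_snd {n m : ℕ} (k : Fin (n + 1)) (x : (Δ[n + 1] : SSet.{u}) _⦋m⦌)
    (i : Fin (m + 1)) : ((simplex k).app _ x).2 i = if x i ≤ k.castSucc then 0 else 1 := by
  have : ((simplex k).app _ x).2 i =
    (stdSimplex.objMk₁.{u} k.succ.castSucc : Δ[1] _⦋n+1⦌) (x i) := rfl
  rw [this, stdSimplex.objMk₁_apply]
  simp [Fin.lt_def, Fin.le_def]

lemma simplex_snd_eq_one_iff {n m : ℕ} (k : Fin (n + 1)) (x : (Δ[n + 1] : SSet.{u}) _⦋m⦌)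
    (i : Fin (m + 1)) : ((simplex k).app _ x).2 i = 1 ↔ (k : ℕ) < x i := by
  rw [simplex_snd]
  simp [Fin.le_def]

lemma simplex_fst_val {n m : ℕ} (k : Fin (n + 1)) (x : (Δ[n + 1] : SSet.{u}) _⦋m⦌)
    (i : Fin (m + 1)) : (((simplex k).app _ x).1 i : ℕ) =
      if (x i : ℕ) ≤ k then (x i : ℕ) else x i - 1 := by
  rw [simplex_fst]
  split_ifs with h
  · rw [Fin.predAbove_of_le_castSucc _ _ (by simpa [Fin.le_def] using h)]; simp
  · rw [Fin.predAbove_of_castSucc_lt _ _ (by simpa [Fin.lt_def] using h)]; simp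

lemma simplex_injective {n : ℕ} (k : Fin (n + 1)) (m : SimplexCategoryᵒᵖ) :
    Function.Injective ((simplex.{u} k).app m) := by
  obtain ⟨m⟩ := m
  induction m using SimplexCategory.rec with | _ m
  intro x y h
  ext i
  have h1 := simplex_fst_val k x i
  have h2 := simplex_snd k x i
  rw [h, simplex_fst_val] at h1
  rw [h, simplex_snd] at h2
  simp only [Fin.le_def, Fin.val_castSucc] at h2
  split_ifs at h1 h2 <;> first | omega | simp at h2

/-- The simplex `k` meets the union of the boundary pieces and of the simplices `k' > k` exactly
in its `k`-th horn. -/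
lemma simplex_mem_stage_iff {n : ℕ} (k : Fin (n + 1)) (m : SimplexCategoryᵒᵖ)
    (x : (Δ[n + 1] : SSet.{u}).obj m) :
    (simplex k).app _ x ∈ (stage n (k + 1)).obj m ↔ x ∈ (horn (n + 1) k.castSucc).obj m := by
  obtain ⟨m⟩ := m
  induction m using SimplexCategory.rec with | _ m
  rw [mem_stage_iff, mem_horn_iff_notMem_range, ← not_iff_not]
  push Not
  constructor
  · rintro ⟨hs, i, hi, hik⟩ j hj
    have hj' : (j : ℕ) ≠ k := fun h ↦ hj (Fin.ext h)
    rw [simplex_fst_val] at hik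
    rw [simplex_snd_eq_one_iff] at hi
    by_cases hjk : (j : ℕ) < k
    · obtain ⟨a, ha⟩ := hs ⟨j, by omega⟩
      have := congr_arg Fin.val ha
      rw [simplex_fst_val] at this
      refine ⟨a, Fin.ext ?_⟩
      dsimp only at this
      split_ifs at this <;> omega
    · by_cases hjk' : (j : ℕ) = k + 1
      · refine ⟨i, Fin.ext ?_⟩
        split_ifs at hik <;> omega
      · obtain ⟨a, ha⟩ := hs ⟨j - 1, by omega⟩
        have := congr_arg Fin.val ha
        rw [simplex_fst_val] at this
        refine ⟨a, Fin.ext ?_⟩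
        dsimp only at this
        split_ifs at this <;> omega
  · intro h
    have h' (j : ℕ) (hj : j < n + 2) (hjk : j ≠ k) : ∃ a, (x a : ℕ) = j := by
      obtain ⟨a, ha⟩ := h ⟨j, hj⟩ (fun h ↦ hjk (congr_arg Fin.val h))
      exact ⟨a, congr_arg Fin.val ha⟩
    refine ⟨fun j ↦ ?_, ?_⟩
    · by_cases hjk : (j : ℕ) < k
      · obtain ⟨a, ha⟩ := h' j (by omega) (by omega)
        refine ⟨a, Fin.ext ?_⟩
        rw [simplex_fst_val]
        split_ifs <;> omega
      · obtain ⟨a, ha⟩ := h' (j + 1) (by omega) (by omega)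
        refine ⟨a, Fin.ext ?_⟩
        rw [simplex_fst_val]
        split_ifs <;> omega
    · obtain ⟨a, ha⟩ := h' (k + 1) (by omega) (by omega)
      refine ⟨a, ?_, ?_⟩
      · rw [simplex_snd_eq_one_iff]
        omega
      · rw [simplex_fst_val]
        split_ifs <;> omega

lemma simplex_mem_stage {n : ℕ} (k : Fin (n + 1)) (m : SimplexCategoryᵒᵖ)
    (x : (Δ[n + 1] : SSet.{u}).obj m) :
    (simplex k).app _ x ∈ (stage n k).obj m := by
  obtain ⟨m⟩ := m
  induction m using SimplexCategory.rec with | _ m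
  refine Or.inr fun i hi ↦ ?_
  change k.val ≤ ((((simplex k).app _ x).1 i : Fin _) : ℕ)
  replace hi : ((simplex k).app _ x).2 i = 1 := hi
  rw [simplex_snd_eq_one_iff] at hi
  rw [simplex_fst_val]
  split_ifs <;> omega

/-- Passing from stage `k + 1` to stage `k` only adds the simplex `k`. -/
lemma exists_simplex_of_mem_stage {n : ℕ} (k : Fin (n + 1)) (m : SimplexCategoryᵒᵖ)
    (x : (Δ[n] ⊗ Δ[1] : SSet.{u}).obj m) (hx : x ∈ (stage n k).obj m)
    (hx' : x ∉ (stage n (k + 1)).obj m) : ∃ y, (simplex k).app _ y = x := by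
  obtain ⟨m⟩ := m
  induction m using SimplexCategory.rec with | _ m
  rw [mem_stage_iff] at hx hx'
  push Not at hx'
  obtain ⟨hs, i, hi, hik⟩ := hx'
  replace hx := hx.resolve_left (not_not_intro hs)
  have h1 := stdSimplex.monotone_apply x.1
  have h2 := stdSimplex.monotone_apply x.2
  -- A vertex with second coordinate `0` precedes `i`, hence its first coordinate is at most `k`.
  have h3 (a : Fin (m + 1)) (ha : x.2 a = 0) : (x.1 a : ℕ) ≤ k := by
    have : a ≤ i := by
      by_contra! h
      have := h2 h.le
      simp [ha, hi] at this
    have := h1 this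
    simp only [Fin.le_def] at this
    omega
  -- On the simplex `k`, the vertex `(a, t)` has index `a + t`.
  let y : (Δ[n + 1] : SSet.{u}) _⦋m⦌ := stdSimplex.objMk
    { toFun a := ⟨x.1 a + x.2 a, by have := (x.1 a).isLt; have := (x.2 a).isLt; dsimp; omega⟩
      monotone' a b hab := by
        have := h1 hab
        have := h2 hab
        simp only [Fin.le_def] at *
        omega }
  have hy (a) : (y a : ℕ) = x.1 a + x.2 a := rfl
  refine ⟨y, Prod.ext ?_ ?_⟩
  · refine stdSimplex.ext _ _ fun a ↦ Fin.ext ?_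
    rw [simplex_fst_val, hy]
    by_cases ha : x.2 a = 0
    · have := h3 a ha
      simp [ha, this]
    · replace ha : x.2 a = 1 := Fin.eq_one_of_ne_zero _ ha
      have := hx a ha
      rw [ha]
      split_ifs
      · simp at *; omega
      · simp
  · refine stdSimplex.ext _ _ fun a ↦ ?_
    rw [simplex_snd]
    simp only [Fin.le_def, Fin.val_castSucc, hy]
    by_cases ha : x.2 a = 0
    · have := h3 a ha
      simp [ha, this]
    · replace ha : x.2 a = 1 := Fin.eq_one_of_ne_zero _ ha
      have := hx a ha
      rw [ha, if_neg]
      simp; omega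

lemma stage_antitone {n j j' : ℕ} (h : j ≤ j') : stage.{u} n j' ≤ stage n j :=
  fun _ _ ↦ Or.imp id fun hx i hi ↦ h.trans (hx i hi)

variable {M S : SSet.{u}} {n : ℕ} (p : M ⟶ S) (q : Δ[n] ⊗ Δ[1] ⟶ S)

/-- The restriction of `prism.simplex k` to the horn `Λ[n + 1, k]`, which lands in stage
`k + 1`. -/
noncomputable def hornToStage (k : Fin (n + 1)) :
    (horn.{u} (n + 1) k.castSucc : SSet.{u}) ⟶ (stage.{u} n (k + 1) : SSet.{u}) :=
  Subcomplex.lift ((horn (n + 1) k.castSucc).ι ≫ simplex k) (by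
    rintro m _ ⟨x, rfl⟩
    exact (simplex_mem_stage_iff k m x.1).2 x.2)

/-- A lift over stage `k + 1` extends to stage `k` as soon as its restriction to the `k`-th horn of
the simplex `k` extends to this simplex. -/
lemma exists_extension_stage (k : Fin (n + 1)) (φ : (stage.{u} n (k + 1) : SSet.{u}) ⟶ M)
    (hφ : φ ≫ p = (stage n (k + 1)).ι ≫ q) (l : Δ[n + 1] ⟶ M)
    (hl : (horn (n + 1) k.castSucc).ι ≫ l = hornToStage k ≫ φ) (hlp : l ≫ p = simplex k ≫ q) :
    ∃ φ' : (stage.{u} n k : SSet.{u}) ⟶ M, φ' ≫ p = (stage n k).ι ≫ q ∧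
      Subcomplex.homOfLE (stage_antitone (Nat.le_succ k)) ≫ φ' = φ := by
  have hl' (m) (x : (Δ[n + 1] : SSet.{u}).obj m)
      (h : (simplex k).app m x ∈ (stage n (k + 1)).obj m) :
      l.app m x = φ.app m ⟨_, h⟩ :=
    congr_app_apply hl ⟨x, (simplex_mem_stage_iff k m x).1 h⟩
  obtain ⟨φ', h⟩ := exists_desc (ι := Bool)
    (Y := fun b ↦ bif b then (stage.{u} n (k + 1) : SSet.{u}) else Δ[n + 1])
    (X := (stage.{u} n k : SSet.{u})) (M := M)
    (fun b ↦ match b with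
      | true => Subcomplex.homOfLE (stage_antitone (Nat.le_succ k))
      | false => Subcomplex.lift (simplex k) (by
          rintro m _ ⟨x, rfl⟩; exact simplex_mem_stage k m x))
    (fun b ↦ match b with
      | true => φ
      | false => l)
    (by
      rintro m ⟨x, hx⟩
      by_cases hx' : x ∈ (stage n (k + 1)).obj m
      · exact ⟨true, ⟨x, hx'⟩, rfl⟩
      · obtain ⟨y, hy⟩ := exists_simplex_of_mem_stage k m x hx hx'
        exact ⟨false, y, Subtype.ext hy⟩)
    (by
      rintro m (_ | _) (_ | _) y z h
      · exact congr_arg _ (simplex_injective k m (congr_arg Subtype.val h))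
      · obtain ⟨z, hz⟩ := z
        obtain rfl : (simplex k).app m y = z := congr_arg Subtype.val h
        exact hl' m y hz
      · obtain ⟨y, hy⟩ := y
        obtain rfl : y = (simplex k).app m z := congr_arg Subtype.val h
        exact (hl' m z hy).symm
      · obtain rfl : y = z := Subtype.ext (congr_arg Subtype.val h :)
        rfl)
  refine ⟨φ', ?_, ?_⟩
  · ext m ⟨x, hx⟩
    by_cases hx' : x ∈ (stage n (k + 1)).obj m
    · exact (congr_arg (p.app m) (h true m ⟨x, hx'⟩)).trans
        (congr_app_apply hφ ⟨x, hx'⟩)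
    · obtain ⟨y, rfl⟩ := exists_simplex_of_mem_stage k m x hx hx'
      exact (congr_arg (p.app m) (h false m y)).trans
        (congr_app_apply hlp y)
  · ext m x
    exact h true m x

lemma simplex_zero_edge :
    (simplex.{u} (0 : Fin (n + 1))).app _ (stdSimplex.edge (n + 1) 0 1 (Fin.zero_le _)) =
      verticalEdge (stdSimplex.obj₀Equiv.symm 0) := by
  refine Prod.ext (SSet.stdSimplex.ext _ _ fun i ↦ ?_) (SSet.stdSimplex.ext _ _ fun i ↦ ?_)
  · refine Fin.ext ((simplex_fst_val _ _ _).trans ?_)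
    fin_cases i <;> rfl
  · refine (simplex_snd _ _ _).trans ?_
    fin_cases i <;> rfl

lemma verticalEdge_mem_stage (j : ℕ) (c) :
    verticalEdge c ∈ (stage.{u} (n + 1) j).obj _ := by
  refine Or.inl fun h ↦ ?_
  obtain ⟨a, ha⟩ := h 0
  obtain ⟨b, hb⟩ := h 1
  have hc (i : Fin 2) : (verticalEdge c).1 i = c 0 :=
    congr_arg c (Subsingleton.elim (α := Fin 1) _ _)
  have : (0 : Fin (n + 2)) = 1 := ha.symm.trans ((hc a).trans ((hc b).symm.trans hb))
  simp at this

/-- A lift over `∂Δ[n + 1] ⊗ Δ[1] ∪ Δ[n + 1] ⊗ {0}` whose edge `{0} × Δ¹` is cocartesian extends to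
`Δ[n + 1] ⊗ Δ[1]`. -/
theorem exists_extension {p : M ⟶ S} [InnerFibration p] (q : Δ[n + 1] ⊗ Δ[1] ⟶ S)
    (φ : ((boundary.{u} (n + 1)).unionProd (stdSimplex.face.{u} (n := 1) {0}) : SSet.{u}) ⟶ M)
    (hφ : φ ≫ p = Subcomplex.ι _ ≫ q)
    (h₀ : verticalEdge (stdSimplex.obj₀Equiv.symm 0) ∈
      ((boundary.{u} (n + 1)).unionProd (stdSimplex.face.{u} (n := 1) {0})).obj _)
    (hφ₀ : IsCocartesianEdge p (φ.app _ ⟨_, h₀⟩)) :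
    ∃ ψ : Δ[n + 1] ⊗ Δ[1] ⟶ M, ψ ≫ p = q ∧ Subcomplex.ι _ ≫ ψ = φ := by
  -- Extend from stage `n + 2` down to stage `0`.
  suffices ∀ j ≤ n + 2, ∃ ψ : (stage.{u} (n + 1) j : SSet.{u}) ⟶ M, ψ ≫ p = Subcomplex.ι _ ≫ q ∧
      ∀ m x hx hx', ψ.app m ⟨x, hx⟩ = φ.app m ⟨x, hx'⟩ by
    obtain ⟨ψ, hψ, h⟩ := this 0 (by omega)
    refine ⟨Subcomplex.lift (𝟙 _) (by rw [stage_zero]; exact le_top) ≫ ψ, ?_, ?_⟩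
    · rw [Category.assoc, hψ]
      rfl
    · ext m x
      exact h _ _ _ _
  intro j hj
  induction hj using Nat.decreasingInduction with
  | self =>
    refine ⟨Subcomplex.homOfLE (stage_last (n + 1)).le ≫ φ, ?_, ?_⟩
    · rw [Category.assoc, hφ]
      rfl
    · intros
      rfl
  | of_succ k hk ih =>
    obtain ⟨ψ, hψ, h⟩ := ih
    obtain ⟨l, hl, hlp⟩ : ∃ l : Δ[n + 2] ⟶ M,
        (horn (n + 2) (Fin.castSucc ⟨k, hk⟩)).ι ≫ l = hornToStage ⟨k, hk⟩ ≫ ψ ∧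
        l ≫ p = simplex ⟨k, hk⟩ ≫ q := by
      have w : (hornToStage ⟨k, hk⟩ ≫ ψ) ≫ p = Subcomplex.ι _ ≫ simplex ⟨k, hk⟩ ≫ q := by
        rw [Category.assoc, hψ]
        rfl
      rcases Nat.eq_zero_or_pos k with rfl | hk₀
      -- The simplex `0` comes last. Its horn is outer, with initial edge `{0} × Δ¹`.
      · refine hφ₀ n _ _ ?_ w
        refine (h _ _ ?_ h₀).symm.trans ?_ |>.symm
        · exact verticalEdge_mem_stage _ _
        · refine congr_arg (ψ.app _) (Subtype.ext ?_)
          exact simplex_zero_edge.symm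
      -- For `0 < k`, the horn is inner.
      · have := mem_innerFibrations p _ (horn_ι_mem_innerHornInclusions (n := n + 2)
          (i := Fin.castSucc ⟨k, hk⟩) hk₀ (Fin.castSucc_lt_last _))
        have sq : CommSq (hornToStage ⟨k, hk⟩ ≫ ψ) (horn (n + 2) (Fin.castSucc ⟨k, hk⟩)).ι p
          (simplex ⟨k, hk⟩ ≫ q) := ⟨w⟩
        exact ⟨sq.lift, sq.fac_left, sq.fac_right⟩
    obtain ⟨ψ', hψ', h'⟩ := exists_extension_stage p q ⟨k, hk⟩ ψ hψ l hl hlp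
    refine ⟨ψ', hψ', fun m x hx hx' ↦ ?_⟩
    have hx'' : x ∈ (stage (n + 1) (k + 1)).obj m :=
      stage_antitone (by omega : k + 1 ≤ n + 1 + 1) _ ((stage_last (n + 1)).ge _ hx')
    rw [← h m x hx'' hx', ← h']
    rfl

end prism

end SSet

/-! ### Extension of lifts over cylinders -/

namespace SSet

variable {K M S : SSet.{u}}

/-- The subcomplex `K × {0} ∪ L × Δ¹` of `K ⊗ Δ[1]`. -/
abbrev cyl (L : K.Subcomplex) : (K ⊗ Δ[1] : SSet.{u}).Subcomplex :=
  L.unionProd (stdSimplex.face.{u} (n := 1) {0})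

lemma mem_cyl_iff (L : K.Subcomplex) {m} (x : (K ⊗ Δ[1] : SSet.{u}).obj m) :
    x ∈ (cyl L).obj m ↔ x.2 ∈ (stdSimplex.face.{u} (n := 1) {0}).obj m ∨ x.1 ∈ L.obj m :=
  Subcomplex.mem_unionProd_iff _ _ _

lemma cyl_mono {L L' : K.Subcomplex} (h : L ≤ L') : cyl L ≤ cyl L' := fun _ x hx ↦
  (mem_cyl_iff L' x).2 (((mem_cyl_iff L x).1 hx).imp id (h _ ·))

lemma verticalEdge_mem_cyl {L : K.Subcomplex} {c : K _⦋0⦌} (hc : c ∈ L.obj _) :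
    verticalEdge c ∈ (cyl L).obj _ :=
  (mem_cyl_iff L _).2 (Or.inr (L.map _ hc))

/-- A lift over `cyl L` extends when a nondegenerate simplex `y` of positive dimension, whose
boundary lies in `L`, is added to `L`, provided that the edge of the lift at the vertex `0` of `y`
is cocartesian. -/
lemma exists_extension_cell {p : M ⟶ S} [InnerFibration p] (q : K ⊗ Δ[1] ⟶ S)
    (L : K.Subcomplex) (φ : (cyl L : SSet.{u}) ⟶ M) (hφ : φ ≫ p = (cyl L).ι ≫ q)
    {n : ℕ} (y : K _⦋n + 1⦌) (hy : y ∈ K.nonDegenerate (n + 1))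
    (hyL : L.preimage (yonedaEquiv.symm y) = boundary (n + 1))
    (h₀ : K.map (SimplexCategory.const ⦋0⦌ ⦋n + 1⦌ 0).op y ∈ L.obj _)
    (hφ₀ : IsCocartesianEdge p (φ.app _ ⟨_, verticalEdge_mem_cyl h₀⟩)) :
    ∃ ψ : (cyl (L ⊔ Subcomplex.ofSimplex y) : SSet.{u}) ⟶ M,
      ψ ≫ p = (cyl (L ⊔ Subcomplex.ofSimplex y)).ι ≫ q ∧
      Subcomplex.homOfLE (cyl_mono le_sup_left) ≫ ψ = φ := by
  let f : Δ[n + 1] ⟶ K := yonedaEquiv.symm y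
  have hf (m) (x : (Δ[n + 1] ⊗ Δ[1] : SSet.{u}).obj m) :
      x ∈ (cyl (boundary (n + 1))).obj m ↔ (f ▷ Δ[1]).app m x ∈ (cyl L).obj m := by
    rw [← hyL]; rfl
  let g : (cyl (boundary.{u} (n + 1)) : SSet.{u}) ⟶ (cyl L : SSet.{u}) :=
    Subcomplex.lift ((cyl (boundary (n + 1))).ι ≫ f ▷ Δ[1]) (by
      rintro m _ ⟨x, rfl⟩
      exact (hf m _).1 x.2)
  have hv : (stdSimplex.obj₀Equiv.symm 0 : (Δ[n + 1] : SSet.{u}) _⦋0⦌) ∈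
      (boundary.{u} (n + 1)).obj _ := by
    rw [boundary_obj_eq_univ 0 (n + 1)]; trivial
  obtain ⟨l, hlp, hl⟩ := prism.exists_extension (p := p) (f ▷ Δ[1] ≫ q) (g ≫ φ)
    (by rw [Category.assoc, hφ]; rfl) (verticalEdge_mem_cyl hv) (by
      convert hφ₀ using 1
      refine congr_arg (φ.app _) (Subtype.ext ?_)
      exact whiskerRight_app_verticalEdge f _)
  have hl' (m) (x : (Δ[n + 1] ⊗ Δ[1] : SSet.{u}).obj m)
      (h : (f ▷ Δ[1]).app m x ∈ (cyl L).obj m) : l.app m x = φ.app m ⟨_, h⟩ :=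
    congr_app_apply hl ⟨x, (hf m x).2 h⟩
  -- By uniqueness in the Eilenberg–Zilber lemma, `f ▷ Δ[1]` is injective outside `cyl L`.
  have hinj (m) (x x' : (Δ[n + 1] ⊗ Δ[1] : SSet.{u}).obj m)
      (h : (f ▷ Δ[1]).app m x ∉ (cyl L).obj m)
      (hx : (f ▷ Δ[1]).app m x = (f ▷ Δ[1]).app m x') : x = x' := by
    rw [← hf, mem_cyl_iff] at h
    push Not at h
    obtain ⟨m⟩ := m
    induction m using SimplexCategory.rec with | _ m
    refine Prod.ext ?_ (congr_arg Prod.snd hx :)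
    have : Epi (SSet.stdSimplex.objEquiv x.1) := by
      rw [SimplexCategory.epi_iff_surjective]
      exact not_not.1 h.2
    exact SSet.stdSimplex.objEquiv.injective (K.unique_nonDegenerate_map (f.app _ x.1)
      (SSet.stdSimplex.objEquiv x.1) ⟨y, hy⟩ rfl (SSet.stdSimplex.objEquiv x'.1) ⟨y, hy⟩
      (congr_arg Prod.fst hx :))
  have hcov (m) (x : (K ⊗ Δ[1] : SSet.{u}).obj m)
      (hx : x ∈ (cyl (L ⊔ Subcomplex.ofSimplex y)).obj m) (hx' : x ∉ (cyl L).obj m) :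
      ∃ z, (f ▷ Δ[1]).app m z = x := by
    rw [mem_cyl_iff] at hx hx'
    obtain hx | hx | hx := hx
    · tauto
    · tauto
    · obtain ⟨x₁, x₂⟩ := x
      obtain ⟨z, rfl⟩ := (Subcomplex.mem_ofSimplex_obj_iff y x₁).1 hx
      exact ⟨(SSet.stdSimplex.objEquiv.symm z, x₂), rfl⟩
  obtain ⟨ψ, h⟩ := exists_desc (ι := Bool)
    (Y := fun b ↦ bif b then (cyl L : SSet.{u}) else Δ[n + 1] ⊗ Δ[1])
    (X := (cyl (L ⊔ Subcomplex.ofSimplex y) : SSet.{u})) (M := M)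
    (fun b ↦ match b with
      | true => Subcomplex.homOfLE (cyl_mono le_sup_left)
      | false => Subcomplex.lift (f ▷ Δ[1]) (by
          rintro m _ ⟨x, rfl⟩
          exact (mem_cyl_iff _ _).2 (Or.inr (Or.inr
            ((Subcomplex.mem_ofSimplex_obj_iff y _).2 ⟨SSet.stdSimplex.objEquiv x.1, rfl⟩)))))
    (fun b ↦ match b with
      | true => φ
      | false => l)
    (by
      rintro m ⟨x, hx⟩
      by_cases hx' : x ∈ (cyl L).obj m
      · exact ⟨true, ⟨x, hx'⟩, rfl⟩
      · obtain ⟨z, hz⟩ := hcov m x hx hx'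
        exact ⟨false, z, Subtype.ext hz⟩)
    (by
      rintro m (_ | _) (_ | _) z z' h
      · replace h : (f ▷ Δ[1]).app m z = (f ▷ Δ[1]).app m z' := congr_arg Subtype.val h
        change l.app m z = l.app m z'
        by_cases hz : (f ▷ Δ[1]).app m z ∈ (cyl L).obj m
        · rw [hl' m z hz, hl' m z' (h ▸ hz)]
          exact congr_arg (φ.app m) (Subtype.ext h)
        · rw [hinj m z z' hz h]
      · obtain ⟨z', hz⟩ := z'
        obtain rfl : (f ▷ Δ[1]).app m z = z' := congr_arg Subtype.val h
        exact hl' m z hz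
      · obtain ⟨z, hz⟩ := z
        obtain rfl : z = (f ▷ Δ[1]).app m z' := congr_arg Subtype.val h
        exact (hl' m z' hz).symm
      · obtain rfl : z = z' := Subtype.ext (congr_arg Subtype.val h :)
        rfl)
  refine ⟨ψ, ?_, ?_⟩
  · ext m ⟨x, hx⟩
    by_cases hx' : x ∈ (cyl L).obj m
    · exact (congr_arg (p.app m) (h true m ⟨x, hx'⟩)).trans
        (congr_app_apply hφ ⟨x, hx'⟩)
    · obtain ⟨z, rfl⟩ := hcov m x hx hx'
      exact (congr_arg (p.app m) (h false m z)).trans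
        (congr_app_apply hlp z)
  · ext m x
    exact h true m x

/-- A map `cyl L ⟶ M` lifting the restriction of `q : K ⊗ Δ[1] ⟶ S` along `p : M ⟶ S`, for some
subcomplex `L` of `K`. -/
structure PartialLift (p : M ⟶ S) (q : K ⊗ Δ[1] ⟶ S) where
  /-- the subcomplex of `K` over which the lift is defined -/
  L : K.Subcomplex
  /-- the lift -/
  φ : (cyl L : SSet.{u}) ⟶ M
  fac : φ ≫ p = (cyl L).ι ≫ q

namespace PartialLift

variable {p : M ⟶ S} {q : K ⊗ Δ[1] ⟶ S}

/-- `Q` extends `P`: it is defined over a larger subcomplex and restricts to `P`. -/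
def Extends (P Q : PartialLift p q) : Prop :=
  P.L ≤ Q.L ∧ ∀ m x (hx : x ∈ (cyl P.L).obj m) (hx' : x ∈ (cyl Q.L).obj m),
    Q.φ.app m ⟨x, hx'⟩ = P.φ.app m ⟨x, hx⟩

lemma Extends.trans {P Q R : PartialLift p q} (h : P.Extends Q) (h' : Q.Extends R) :
    P.Extends R :=
  ⟨h.1.trans h'.1, fun m x hx hx' ↦
    (h'.2 m x (cyl_mono h.1 _ hx) hx').trans (h.2 m x hx _)⟩

lemma exists_upper_bound (c : Set (PartialLift p q)) (hc : IsChain Extends c) (hc' : c.Nonempty) :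
    ∃ Q, ∀ P ∈ c, Extends P Q := by
  let L : K.Subcomplex := ⨆ P : c, P.1.L
  have hL (P : c) : P.1.L ≤ L := le_iSup (fun P : c ↦ P.1.L) P
  have hcov (m) (x : (K ⊗ Δ[1] : SSet.{u}).obj m) (hx : x ∈ (cyl L).obj m) :
      ∃ P : c, x ∈ (cyl P.1.L).obj m := by
    obtain ⟨P, hP⟩ := hc'
    rw [mem_cyl_iff] at hx
    obtain hx | hx := hx
    · exact ⟨⟨P, hP⟩, (mem_cyl_iff _ _).2 (Or.inl hx)⟩
    · rw [Subfunctor.iSup_obj, Set.mem_iUnion] at hx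
      obtain ⟨Q, hQ⟩ := hx
      exact ⟨Q, (mem_cyl_iff _ _).2 (Or.inr hQ)⟩
  obtain ⟨ψ, h⟩ := exists_desc (ι := c) (X := (cyl L : SSet.{u}))
    (fun P ↦ Subcomplex.homOfLE (cyl_mono (hL P))) (fun P ↦ P.1.φ)
    (by
      rintro m ⟨x, hx⟩
      obtain ⟨P, hP⟩ := hcov m x hx
      exact ⟨P, ⟨x, hP⟩, rfl⟩)
    (by
      rintro m P Q ⟨y, hy⟩ ⟨z, hz⟩ h
      obtain rfl : y = z := congr_arg Subtype.val h
      by_cases hPQ : P = Q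
      · subst hPQ; rfl
      obtain h | h := hc P.2 Q.2 (fun h ↦ hPQ (Subtype.ext h))
      · exact (h.2 m y hy hz).symm
      · exact h.2 m y hz hy)
  refine ⟨⟨L, ψ, ?_⟩, fun P hP ↦ ⟨hL ⟨P, hP⟩, fun m x hx _ ↦ h ⟨P, hP⟩ m ⟨x, hx⟩⟩⟩
  ext m ⟨x, hx⟩
  obtain ⟨P, hP⟩ := hcov m x hx
  exact (congr_arg (p.app m) (h P m ⟨x, hP⟩)).trans
    (congr_app_apply P.1.fac ⟨x, hP⟩)

/-- Zorn's lemma for partial lifts. -/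
lemma exists_maximal (P : PartialLift p q) :
    ∃ Q, P.Extends Q ∧ ∀ R, Q.Extends R → R.L ≤ Q.L := by
  obtain ⟨Q, hQ⟩ := exists_maximal_of_chains_bounded
    (α := {Q : PartialLift p q // P.Extends Q}) (r := fun Q R ↦ Q.1.Extends R.1)
    (fun c hc ↦ by
      obtain rfl | hc' := c.eq_empty_or_nonempty
      · exact ⟨⟨P, le_rfl, fun _ _ _ _ ↦ rfl⟩, by simp⟩
      · obtain ⟨R, hR⟩ := exists_upper_bound (Subtype.val '' c)
          (by
            rintro _ ⟨x, hx, rfl⟩ _ ⟨y, hy, rfl⟩ hxy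
            exact hc hx hy (fun h ↦ hxy (congr_arg _ h))) (hc'.image _)
        obtain ⟨x, hx⟩ := hc'
        exact ⟨⟨R, x.2.trans (hR x.1 ⟨x, hx, rfl⟩)⟩, fun a ha ↦ hR a.1 ⟨a, ha, rfl⟩⟩)
    (fun h h' ↦ h.trans h')
  exact ⟨Q.1, Q.2, fun R hR ↦ (hQ ⟨R, Q.2.trans hR⟩ hR).1⟩

end PartialLift

/-- A lift over `cyl L` extends to `K ⊗ Δ[1]` if `L` contains all the vertices of `K`, and if
the edge of the lift at the vertex `0` of each simplex which is not in `L` is cocartesian. -/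
theorem exists_extension_of_isCocartesianEdge {p : M ⟶ S} [InnerFibration p]
    (q : K ⊗ Δ[1] ⟶ S) (L : K.Subcomplex) (hL : ∀ c : K _⦋0⦌, c ∈ L.obj _)
    (φ : (cyl L : SSet.{u}) ⟶ M) (hφ : φ ≫ p = (cyl L).ι ≫ q)
    (hcoc : ∀ (n : ℕ) (y : K _⦋n⦌), y ∉ L.obj _ →
      IsCocartesianEdge p (φ.app _ ⟨_, verticalEdge_mem_cyl
        (hL (K.map (SimplexCategory.const ⦋0⦌ ⦋n⦌ 0).op y))⟩)) :
    ∃ ψ : K ⊗ Δ[1] ⟶ M, ψ ≫ p = q ∧ (cyl L).ι ≫ ψ = φ := by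
  obtain ⟨Q, hPQ, hQ⟩ := PartialLift.exists_maximal ⟨L, φ, hφ⟩
  have hQ' : Q.L = ⊤ := by
    by_contra hne
    have hex : ∃ n, ∃ y : K _⦋n⦌, y ∉ Q.L.obj _ := by
      by_contra! h
      refine hne ?_
      ext ⟨m⟩ x
      induction m using SimplexCategory.rec with | _ m
      exact iff_of_true (h m x) trivial
    classical
    obtain ⟨y, hy⟩ := Nat.find_spec hex
    have hmin (k) (hk : k < Nat.find hex) (z : K _⦋k⦌) : z ∈ Q.L.obj _ := by
      by_contra hz
      exact Nat.find_min hex hk ⟨z, hz⟩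
    -- `y` has minimal dimension among the simplices of `K` which are not in `Q.L`.
    generalize Nat.find hex = n at y hy hmin
    obtain _ | n := n
    · exact hy (hPQ.1 _ (hL y))
    have hnd : y ∈ K.nonDegenerate (n + 1) := by
      rw [mem_nonDegenerate_iff_notMem_degenerate]
      rintro ⟨m, hm, f, z, rfl⟩
      exact hy (Q.L.map _ (hmin m hm z))
    have hbd : Q.L.preimage (yonedaEquiv.symm y) = boundary (n + 1) := by
      rw [stdSimplex.eq_boundary_iff]
      refine ⟨?_, fun h ↦ ?_⟩
      · rw [boundary_eq_iSup]
        refine iSup_le fun i ↦ ?_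
        rw [stdSimplex.face_singleton_compl, Subcomplex.ofSimplex_le_iff]
        exact hmin n (by omega) _
      · apply hy
        have : yonedaEquiv (𝟙 _) ∈ (Q.L.preimage (yonedaEquiv.symm y)).obj _ := by
          rw [h]; trivial
        simpa using this
    obtain ⟨ψ, hψ, hψ'⟩ := exists_extension_cell (p := p) q Q.L Q.φ Q.fac y hnd hbd
      (hPQ.1 _ (hL _)) (by
        rw [hPQ.2 _ _ (verticalEdge_mem_cyl (hL _))]
        exact hcoc _ y (fun h ↦ hy (hPQ.1 _ h)))
    refine hy (hQ ⟨_, ψ, hψ⟩ ⟨le_sup_left, ?_⟩ _ (Or.inr (Subcomplex.mem_ofSimplex_obj y)))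
    intro m x hx _
    rw [← hψ']
    rfl
  have hmem (m) (x : (K ⊗ Δ[1] : SSet.{u}).obj m) : x ∈ (cyl Q.L).obj m :=
    (mem_cyl_iff _ _).2 (Or.inr (by rw [hQ']; trivial))
  refine ⟨Subcomplex.lift (𝟙 _) (fun m x _ ↦ hmem m x) ≫ Q.φ, ?_, ?_⟩
  · rw [Category.assoc, Q.fac]
    rfl
  · ext m ⟨x, hx⟩
    exact hPQ.2 m x hx _

/-! ### Gluing lifts -/

instance mono_whiskerRight {X Y : SSet.{u}} (f : X ⟶ Y) [Mono f] (Z : SSet.{u}) :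
    Mono (f ▷ Z) := by
  rw [NatTrans.mono_iff_mono_app]
  intro m
  rw [mono_iff_injective]
  intro x y h
  exact Prod.ext ((mono_iff_injective (f.app m)).1 inferInstance (congr_arg Prod.fst h))
    (congr_arg Prod.snd h :)

instance mono_ι₀ {X : SSet.{u}} : Mono (ι₀ : X ⟶ X ⊗ Δ[1]) :=
  mono_of_mono_fac (ι₀_fst X)

/-- A variant of `exists_desc`: three lifts along `p` defined on monomorphisms into `X` which cover
a subcomplex `Z`, and which agree on overlaps, glue to a lift over `Z`. -/
lemma exists_lift_desc₃ {X Y₁ Y₂ Y₃ M S : SSet.{u}} {p : M ⟶ S} {q : X ⟶ S} (Z : X.Subcomplex)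
    (σ₁ : Y₁ ⟶ X) (σ₂ : Y₂ ⟶ X) (σ₃ : Y₃ ⟶ X) (ψ₁ : Y₁ ⟶ M) (ψ₂ : Y₂ ⟶ M) (ψ₃ : Y₃ ⟶ M)
    (hσ₁ : ∀ m y, σ₁.app m y ∈ Z.obj m) (hσ₂ : ∀ m y, σ₂.app m y ∈ Z.obj m)
    (hσ₃ : ∀ m y, σ₃.app m y ∈ Z.obj m)
    (hZ : ∀ m, ∀ x ∈ Z.obj m, (∃ y, σ₁.app m y = x) ∨ (∃ y, σ₂.app m y = x) ∨
      (∃ y, σ₃.app m y = x))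
    [Mono σ₁] [Mono σ₂] [Mono σ₃]
    (h₁₂ : ∀ m y z, σ₁.app m y = σ₂.app m z → ψ₁.app m y = ψ₂.app m z)
    (h₁₃ : ∀ m y z, σ₁.app m y = σ₃.app m z → ψ₁.app m y = ψ₃.app m z)
    (h₂₃ : ∀ m y z, σ₂.app m y = σ₃.app m z → ψ₂.app m y = ψ₃.app m z)
    (hp₁ : ψ₁ ≫ p = σ₁ ≫ q) (hp₂ : ψ₂ ≫ p = σ₂ ≫ q) (hp₃ : ψ₃ ≫ p = σ₃ ≫ q) :
    ∃ φ : (Z : SSet.{u}) ⟶ M, φ ≫ p = Z.ι ≫ q ∧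
      (∀ m y h, φ.app m ⟨σ₁.app m y, h⟩ = ψ₁.app m y) ∧
      (∀ m y h, φ.app m ⟨σ₂.app m y, h⟩ = ψ₂.app m y) ∧
      (∀ m y h, φ.app m ⟨σ₃.app m y, h⟩ = ψ₃.app m y) := by
  have inj {Y : SSet.{u}} (σ : Y ⟶ X) [Mono σ] (m) (y z : Y.obj m)
      (h : σ.app m y = σ.app m z) : y = z :=
    (mono_iff_injective (σ.app m)).1 inferInstance h
  obtain ⟨φ, h⟩ := exists_desc (ι := Option Bool) (X := (Z : SSet.{u})) (M := M)
    (Y := fun b ↦ match b with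
      | none => Y₁
      | some true => Y₂
      | some false => Y₃)
    (fun b ↦ match b with
      | none => Subcomplex.lift σ₁ (by rintro m _ ⟨y, rfl⟩; exact hσ₁ m y)
      | some true => Subcomplex.lift σ₂ (by rintro m _ ⟨y, rfl⟩; exact hσ₂ m y)
      | some false => Subcomplex.lift σ₃ (by rintro m _ ⟨y, rfl⟩; exact hσ₃ m y))
    (fun b ↦ match b with
      | none => ψ₁
      | some true => ψ₂
      | some false => ψ₃)
    (by
      rintro m ⟨x, hx⟩
      obtain ⟨y, rfl⟩ | ⟨y, rfl⟩ | ⟨y, rfl⟩ := hZ m x hx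
      · exact ⟨none, y, rfl⟩
      · exact ⟨some true, y, rfl⟩
      · exact ⟨some false, y, rfl⟩)
    (by
      rintro m (_ | _ | _) (_ | _ | _) y z h <;> replace h := congr_arg Subtype.val h
      · exact congr_arg _ (inj σ₁ m y z h)
      · exact h₁₃ m y z h
      · exact h₁₂ m y z h
      · exact (h₁₃ m z y h.symm).symm
      · exact congr_arg _ (inj σ₃ m y z h)
      · exact (h₂₃ m z y h.symm).symm
      · exact (h₁₂ m z y h.symm).symm
      · exact h₂₃ m y z h
      · exact congr_arg _ (inj σ₂ m y z h))
  refine ⟨φ, ?_, fun m y _ ↦ h none m y, fun m y _ ↦ h (some true) m y,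
    fun m y _ ↦ h (some false) m y⟩
  ext m ⟨x, hx⟩
  obtain ⟨y, rfl⟩ | ⟨y, rfl⟩ | ⟨y, rfl⟩ := hZ m x hx
  · exact (congr_arg (p.app m) (h none m y)).trans
      (congr_app_apply hp₁ y)
  · exact (congr_arg (p.app m) (h (some true) m y)).trans
      (congr_app_apply hp₂ y)
  · exact (congr_arg (p.app m) (h (some false) m y)).trans
      (congr_app_apply hp₃ y)

lemma verticalEdge_fst_mem {X : SSet.{u}} {A : X.Subcomplex} {c : X _⦋0⦌} (hc : c ∈ A.obj _) :
    (verticalEdge c).1 ∈ A.obj _ :=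
  A.map (SimplexCategory.σ 0).op hc

lemma ι₀_app_eq {X : SSet.{u}} {m} (x : (X ⊗ Δ[1] : SSet.{u}).obj m)
    (hx : x.2 ∈ (stdSimplex.face.{u} (n := 1) {0}).obj m) : ι₀.app m x.1 = x := by
  obtain ⟨m⟩ := m
  induction m using SimplexCategory.rec with | _ m
  refine Prod.ext rfl (SSet.stdSimplex.ext _ _ fun i ↦ ?_)
  rw [stdSimplex.mem_face_iff] at hx
  exact (Finset.mem_singleton.1 (hx i)).symm

lemma ι₀_mem_face {X : SSet.{u}} {m} (x : X.obj m) :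
    (ι₀.app m x).2 ∈ (stdSimplex.face.{u} (n := 1) {0}).obj m := by
  obtain ⟨m⟩ := m
  induction m using SimplexCategory.rec with | _ m
  exact (stdSimplex.mem_face_iff _ _).2 fun i ↦ Finset.mem_singleton.2 rfl

end SSet

/-! ### Fibers over the vertices of `Δ[1]` -/

section

variable {K : SSet.{u}} (s : K ⟶ Δ[1])

lemma mem_fiber_iff {j : Fin 2} {n : ℕ} (y : K _⦋n⦌) :
    y ∈ (fiber s j).obj _ ↔ ∀ i : Fin (n + 1), (s.app _ y : Δ[1] _⦋n⦌) i = j := by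
  refine (stdSimplex.mem_face_iff _ _).trans ?_
  simp

/-- A simplex which does not lie over the vertex `1` starts over the vertex `0`. -/
lemma vertex_mem_fiber_zero {n : ℕ} {y : K _⦋n⦌} (hy : y ∉ (fiber s 1).obj _) :
    K.map (SimplexCategory.const ⦋0⦌ ⦋n⦌ 0).op y ∈ (fiber s 0).obj _ := by
  rw [mem_fiber_iff] at hy ⊢
  intro i
  rw [NatTrans.naturality_apply]
  change (s.app _ y : Δ[1] _⦋n⦌) 0 = 0
  by_contra h
  have h' := Fin.eq_one_of_ne_zero _ h
  refine hy fun i ↦ Fin.eq_one_of_ne_zero _ fun hi ↦ ?_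
  have := SSet.stdSimplex.monotone_apply (s.app _ y) (Fin.zero_le i)
  simp [h', hi] at this

lemma mem_fiber_zero_or_one (c : K _⦋0⦌) : c ∈ (fiber s 0).obj _ ∨ c ∈ (fiber s 1).obj _ := by
  by_cases h : c ∈ (fiber s 1).obj _
  · exact Or.inr h
  · refine Or.inl ?_
    have := vertex_mem_fiber_zero s h
    have h' : SimplexCategory.const ⦋0⦌ ⦋0⦌ 0 = 𝟙 _ := Subsingleton.elim _ _
    rwa [h', op_id, CategoryTheory.Functor.map_id] at this

lemma exists_mem_fiber_of_isIso {K' : SSet.{u}} (i : K' ⟶ K) (j : Fin 2)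
    (hi : IsIso (fiberMap i s j)) {m} (x : K.obj m) (hx : x ∈ (fiber s j).obj m) :
    ∃ w ∈ (fiber (i ≫ s) j).obj m, i.app m w = x := by
  let w := (inv (fiberMap i s j)).app m ⟨x, hx⟩
  have h : (fiberMap i s j).app m w = ⟨x, hx⟩ :=
    congr_app_apply (IsIso.inv_hom_id (fiberMap i s j)) ⟨x, hx⟩
  exact ⟨w.1, w.2, congr_arg Subtype.val h⟩

end

/-! ### Adjunct maps -/

namespace AssociatedData

variable {M C D : SSet.{u}} {p : M ⟶ Δ[1]} {f : C ⟶ D} {g : D ⟶ C} (d : AssociatedData p f g)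
  {K : SSet.{u}}

/-- If `L` contains both fibers of `s`, then a lift over `cyl L` which is given by `u` over the
fiber at `0` extends to `K ⊗ Δ[1]`: the simplices which are not in `L` start in the fiber at
`0`, where the edges of `u` are cocartesian. -/
lemma exists_extension [InnerFibration p] (s : K ⟶ Δ[1]) (α : K ⟶ C) (L : K.Subcomplex)
    (h₀ : fiber s 0 ≤ L) (h₁ : fiber s 1 ≤ L) (φ : (cyl L : SSet.{u}) ⟶ M)
    (hφ : φ ≫ p = (cyl L).ι ≫ snd K Δ[1])
    (hu : ∀ m x (hx : x ∈ (cyl L).obj m), x.1 ∈ (fiber s 0).obj m →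
      φ.app m ⟨x, hx⟩ = d.u.app m ((α ▷ Δ[1]).app m x)) :
    ∃ ψ : K ⊗ Δ[1] ⟶ M, ψ ≫ p = snd K Δ[1] ∧ (cyl L).ι ≫ ψ = φ := by
  refine exists_extension_of_isCocartesianEdge (p := p) _ L
    (fun c ↦ (mem_fiber_zero_or_one s c).elim (h₀ _ ·) (h₁ _ ·)) φ hφ fun n y hy ↦ ?_
  have := vertex_mem_fiber_zero s (fun h ↦ hy (h₁ _ h))
  have e := hu _ _ (verticalEdge_mem_cyl (h₀ _ this)) (verticalEdge_fst_mem this)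
  rw [whiskerRight_app_verticalEdge, ← edgeAt_eq] at e
  exact e ▸ d.u_cocartesian _

/-- The restriction of a lift to `K × {1}` lies in the fiber at `1`, that is, in `D`. -/
lemma exists_eq_comp_h₁ (ψ : K ⊗ Δ[1] ⟶ M) (hψ : ψ ≫ p = snd K Δ[1]) :
    ∃ β : K ⟶ D, ι₁ ≫ ψ = β ≫ d.h₁.hom ≫ (fiber p 1).ι := by
  suffices h : Subcomplex.range (ι₁ ≫ ψ) ≤ fiber p 1 from
    ⟨Subcomplex.lift (ι₁ ≫ ψ) h ≫ d.h₁.inv, by simp⟩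
  rintro ⟨m⟩ _ ⟨x, rfl⟩
  induction m using SimplexCategory.rec with | _ m
  refine (mem_fiber_iff p _).2 fun i ↦ ?_
  have : p.app _ (ψ.app _ (ι₁.app _ x)) = (ι₁.app _ x).2 :=
    congr_app_apply hψ _
  change (p.app _ (ψ.app _ (ι₁.app _ x)) : Δ[1] _⦋m⦌) i = 1
  rw [this]
  rfl

lemma eq_of_comp_h₁ {β β' : K ⟶ D}
    (h : β ≫ d.h₁.hom ≫ (fiber p 1).ι = β' ≫ d.h₁.hom ≫ (fiber p 1).ι) : β = β' := by
  rwa [cancel_mono] at h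

end AssociatedData

/-- Existence: glue the given adjunction map over `K'`, the map `u` over the fiber at `0` and the
map `α` on `K × {0}`, and extend the result. -/
theorem exists_isAdjunct_extension {M C D : SSet.{u}} {p : M ⟶ Δ[1]} [InnerFibration p]
    {f : C ⟶ D} {g : D ⟶ C} (d : AssociatedData p f g)
    {K' K : SSet.{u}} (s : K ⟶ Δ[1]) (i : K' ⟶ K) [Mono i] (hi₁ : IsIso (fiberMap i s 1))
    (α : K ⟶ C) (β' : K' ⟶ D) (h : IsAdjunct d (i ≫ s) (i ≫ α) β') :
    ∃ β : K ⟶ D, i ≫ β = β' ∧ IsAdjunct d s α β := by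
  obtain ⟨A, hAp, hA₀, hA₁, hAu, hAv⟩ := h
  have hL₁ : fiber s 1 ≤ Subcomplex.range i ⊔ fiber s 0 := fun m x hx ↦ by
    obtain ⟨w, _, rfl⟩ := exists_mem_fiber_of_isIso s i 1 hi₁ x hx
    exact Or.inl ⟨w, rfl⟩
  have hm₁ (m) (y : (K' ⊗ Δ[1] : SSet.{u}).obj m) :
      (i ▷ Δ[1]).app m y ∈ (cyl (Subcomplex.range i ⊔ fiber s 0)).obj m :=
    (mem_cyl_iff _ _).2 (Or.inr (Or.inl ⟨y.1, rfl⟩))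
  have hm₂ (m) (y : ((fiber s 0 : SSet.{u}) ⊗ Δ[1] : SSet.{u}).obj m) :
      ((fiber s 0).ι ▷ Δ[1]).app m y ∈ (cyl (Subcomplex.range i ⊔ fiber s 0)).obj m :=
    (mem_cyl_iff _ _).2 (Or.inr (Or.inr y.1.2))
  have hm₃ (m) (y : K.obj m) :
      ι₀.app m y ∈ (cyl (Subcomplex.range i ⊔ fiber s 0)).obj m :=
    (mem_cyl_iff _ _).2 (Or.inl (ι₀_mem_face y))
  obtain ⟨φ, hφ, hφA, hφu, hφ₀⟩ := exists_lift_desc₃ (p := p) (q := snd K Δ[1])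
    (cyl (Subcomplex.range i ⊔ fiber s 0)) (i ▷ Δ[1]) ((fiber s 0).ι ▷ Δ[1]) ι₀
    A (((fiber s 0).ι ≫ α) ▷ Δ[1] ≫ d.u) (α ≫ d.h₀.hom ≫ (fiber p 0).ι)
    hm₁ hm₂ hm₃
    (fun m x hx ↦ by
      rw [mem_cyl_iff] at hx
      obtain hx | ⟨y, hy⟩ | hx := hx
      · exact Or.inr (Or.inr ⟨x.1, ι₀_app_eq x hx⟩)
      · exact Or.inl ⟨(y, x.2), Prod.ext hy rfl⟩
      · exact Or.inr (Or.inl ⟨(⟨x.1, hx⟩, x.2), rfl⟩))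
    (by
      rintro m ⟨w, t⟩ ⟨⟨x, hx⟩, t'⟩ h
      obtain rfl : i.app m w = x := congr_arg Prod.fst h
      obtain rfl : t = t' := congr_arg Prod.snd h
      exact congr_app_apply hAu
        ((⟨w, hx⟩, t) : ((fiber (i ≫ s) 0 : SSet.{u}) ⊗ Δ[1] : SSet.{u}).obj m))
    (by
      rintro m ⟨w, t⟩ x h
      obtain rfl : i.app m w = x := congr_arg Prod.fst h
      have ht : (ι₀ : K' ⟶ _).app m w = (w, t) := Prod.ext rfl (congr_arg Prod.snd h).symm
      rw [← ht]
      exact congr_app_apply hA₀ w)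
    (by
      rintro m ⟨⟨y, hy⟩, t⟩ x h
      obtain rfl : y = x := congr_arg Prod.fst h
      have ht : (ι₀ : C ⟶ _).app m (α.app m y) = (α.app m y, t) :=
        Prod.ext rfl (congr_arg Prod.snd h).symm
      refine Eq.trans ?_ (congr_app_apply d.u_zero (α.app m y))
      exact congr_arg (d.u.app m) ht.symm)
    (by rw [hAp]; rfl)
    (by rw [Category.assoc, d.u_p]; rfl)
    (by
      have := d.u_zero =≫ p
      rw [Category.assoc, d.u_p] at this
      rw [Category.assoc, ← this]
      rfl)
  obtain ⟨ψ, hψ, hψφ⟩ := d.exists_extension s α _ le_sup_right hL₁ φ hφ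
    (fun m x hx hx' ↦ hφu m (⟨x.1, hx'⟩, x.2) hx)
  have hψφ' (m) (x) (hx : x ∈ (cyl (Subcomplex.range i ⊔ fiber s 0)).obj m) :
      ψ.app m x = φ.app m ⟨x, hx⟩ :=
    congr_app_apply hψφ ⟨x, hx⟩
  have hψA : i ▷ Δ[1] ≫ ψ = A := by
    ext m x
    exact (hψφ' m _ (hm₁ m x)).trans (hφA m x _)
  obtain ⟨β, hβ⟩ := d.exists_eq_comp_h₁ ψ hψ
  have hiβ : i ≫ β = β' := by
    refine d.eq_of_comp_h₁ ?_
    rw [← hA₁, Category.assoc, ← hβ, ← ι₁_comp_assoc, hψA]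
  refine ⟨β, hiβ, ψ, hψ, ?_, hβ, ?_, ?_⟩
  · ext m x
    exact (hψφ' m _ (hm₃ m x)).trans (hφ₀ m x _)
  · ext m x
    exact (hψφ' m _ (hm₂ m x)).trans (hφu m x _)
  · ext m ⟨⟨x, hx⟩, t⟩
    obtain ⟨w, hw, rfl⟩ := exists_mem_fiber_of_isIso s i 1 hi₁ x hx
    subst hiβ
    refine Eq.trans ?_ (congr_app_apply hAv
      ((⟨w, hw⟩, t) : ((fiber (i ≫ s) 1 : SSet.{u}) ⊗ Δ[1] : SSet.{u}).obj m))
    exact congr_app_apply hψA (w, t)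

/-! ### Equivalences of functors from the walking isomorphism -/

namespace SSet

lemma coherentIso.const_x₀_app_ne {X : SSet.{u}} {m : SimplexCategoryᵒᵖ}
    (x y : X.obj m) :
    (SSet.const (X := X) coherentIso.x₀.{u}).app m x ≠
      (SSet.const (X := X) coherentIso.x₁.{u}).app m y := by
  intro h
  have : (WalkingIso.zero.{u} : WalkingIso) = WalkingIso.one :=
    congr_arg (fun F : ComposableArrows WalkingIso.{u} m.unop.len ↦ F.obj 0) h
  simp [WalkingIso.zero, WalkingIso.one] at this

/-- The inclusion `K × {x} ⟶ K ⊗ J` for a vertex `x` of `J`. -/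
noncomputable def slice (K : SSet.{u}) {J : SSet.{u}} (x : J _⦋0⦌) : K ⟶ K ⊗ J :=
  lift (𝟙 K) (SSet.const x)

instance {K J : SSet.{u}} (x : J _⦋0⦌) : Mono (slice K x) :=
  mono_of_mono_fac (lift_fst (𝟙 K) (SSet.const x))

lemma curry_app_eq_funVertex {K D J : SSet.{u}} (β : K ⊗ J ⟶ D) (x : J _⦋0⦌) :
    (MonoidalClosed.curry β).app _ x = funVertex (slice K x ≫ β) := by
  let η : 𝟙_ SSet.{u} ⟶ J := (unitHomEquiv J).symm x
  have hη : η.app _ PUnit.unit = x := (unitHomEquiv J).apply_symm_apply x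
  have h : (ρ_ K).hom ≫ slice K x = K ◁ η := rfl
  rw [funVertex, ← Category.assoc, h, MonoidalClosed.curry_natural_left]
  change _ = (MonoidalClosed.curry β).app _ (η.app _ PUnit.unit)
  rw [hη]

/-- A map out of `K ⊗ J`, for `J` the nerve of the walking isomorphism, is an equivalence between
its restrictions to the two ends. -/
lemma functorsEquivalent_of_coherentIso {K D : SSet.{u}} (β : K ⊗ coherentIso.{u} ⟶ D) :
    FunctorsEquivalent (slice K coherentIso.x₀ ≫ β) (slice K coherentIso.x₁ ≫ β) :=
  ⟨(coherentIso.hom.map (MonoidalClosed.curry β)).ofEq (curry_app_eq_funVertex β _)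
    (curry_app_eq_funVertex β _),
    ⟨coherentIso.invStructOfEqMapHom (g := MonoidalClosed.curry β) rfl⟩⟩

end SSet

/-! ### Uniqueness of adjunct extensions -/

/-- Maps adjunct to `α` which agree on the fiber at `1` are equivalent. Their adjunction maps agree
over both fibers and on `K × {0}`, hence glue to a lift over `cyl L ≤ K ⊗ J ⊗ Δ[1]`, where `J` is
the nerve of the walking isomorphism and `L` consists of the two ends `K × {x}` of `K ⊗ J` together
with the product of the two fibers with `J`. An extension to `K ⊗ J ⊗ Δ[1]` yields an
equivalence. -/
theorem functorsEquivalent_of_isAdjunct {M C D : SSet.{u}} {p : M ⟶ Δ[1]} [InnerFibration p]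
    {f : C ⟶ D} {g : D ⟶ C} (d : AssociatedData p f g) {K : SSet.{u}} (s : K ⟶ Δ[1])
    (α : K ⟶ C) (β₁ β₂ : K ⟶ D) (h₁ : IsAdjunct d s α β₁) (h₂ : IsAdjunct d s α β₂)
    (hβ : (fiber s 1).ι ≫ β₁ = (fiber s 1).ι ≫ β₂) : FunctorsEquivalent β₁ β₂ := by
  obtain ⟨A₁, hAp₁, hA₁₀, hA₁₁, hAu₁, hAv₁⟩ := h₁
  obtain ⟨A₂, hAp₂, hA₂₀, hA₂₁, hAu₂, hAv₂⟩ := h₂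
  let L₀ : K.Subcomplex := fiber s 0 ⊔ fiber s 1
  have hA (m) (x : (K ⊗ Δ[1] : SSet.{u}).obj m) (hx : x ∈ (cyl L₀).obj m) :
      A₁.app m x = A₂.app m x := by
    rw [mem_cyl_iff] at hx
    obtain hx | hx | hx := hx
    · rw [← ι₀_app_eq x hx]
      exact congr_app_apply (hA₁₀.trans hA₂₀.symm) x.1
    · exact congr_app_apply (hAu₁.trans hAu₂.symm)
        ((⟨x.1, hx⟩, x.2) : ((fiber s 0 : SSet.{u}) ⊗ Δ[1] : SSet.{u}).obj m)
    · rw [hβ] at hAv₁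
      exact congr_app_apply (hAv₁.trans hAv₂.symm)
        ((⟨x.1, hx⟩, x.2) : ((fiber s 1 : SSet.{u}) ⊗ Δ[1] : SSet.{u}).obj m)
  let J := coherentIso.{u}
  let i₀ : K ⟶ K ⊗ J := slice K coherentIso.x₀
  let i₁ : K ⟶ K ⊗ J := slice K coherentIso.x₁
  let L₁ : (K ⊗ J).Subcomplex := L₀.preimage (fst K J)
  let L : (K ⊗ J).Subcomplex := Subcomplex.range i₀ ⊔ Subcomplex.range i₁ ⊔ L₁
  have hm₁ (m) (y : (K ⊗ Δ[1] : SSet.{u}).obj m) : (i₀ ▷ Δ[1]).app m y ∈ (cyl L).obj m :=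
    (mem_cyl_iff _ _).2 (Or.inr (Or.inl (Or.inl ⟨y.1, rfl⟩)))
  have hm₂ (m) (y : (K ⊗ Δ[1] : SSet.{u}).obj m) : (i₁ ▷ Δ[1]).app m y ∈ (cyl L).obj m :=
    (mem_cyl_iff _ _).2 (Or.inr (Or.inl (Or.inr ⟨y.1, rfl⟩)))
  have hm₃ (m) (y : (cyl L₁ : SSet.{u}).obj m) : (cyl L₁).ι.app m y ∈ (cyl L).obj m :=
    cyl_mono (le_sup_right : L₁ ≤ L) _ y.2
  obtain ⟨φ, hφ, hφ₁, hφ₂, hφ₃⟩ := exists_lift_desc₃ (p := p) (q := snd (K ⊗ J) Δ[1])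
    (cyl L) (i₀ ▷ Δ[1]) (i₁ ▷ Δ[1]) (cyl L₁).ι A₁ A₂ ((cyl L₁).ι ≫ fst K J ▷ Δ[1] ≫ A₁)
    hm₁ hm₂ hm₃
    (fun m x hx ↦ by
      rw [mem_cyl_iff] at hx
      obtain hx | (⟨y, hy⟩ | ⟨y, hy⟩) | hx := hx
      · exact Or.inr (Or.inr ⟨⟨x, (mem_cyl_iff _ _).2 (Or.inl hx)⟩, rfl⟩)
      · exact Or.inl ⟨(y, x.2), Prod.ext hy rfl⟩
      · exact Or.inr (Or.inl ⟨(y, x.2), Prod.ext hy rfl⟩)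
      · exact Or.inr (Or.inr ⟨⟨x, (mem_cyl_iff _ _).2 (Or.inr hx)⟩, rfl⟩))
    -- The two ends of `K ⊗ J` are disjoint.
    (fun m y z h ↦ by
      have := congr_arg (fun w : ((K ⊗ J) ⊗ Δ[1] : SSet.{u}).obj m ↦ w.1.2) h
      exact (coherentIso.const_x₀_app_ne y.1 z.1 this).elim)
    (by
      rintro m y ⟨z, hz⟩ h
      obtain rfl : (i₀ ▷ Δ[1]).app m y = z := h
      rfl)
    (by
      rintro m y ⟨z, hz⟩ h
      obtain rfl : (i₁ ▷ Δ[1]).app m y = z := h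
      refine (hA m y ?_).symm
      rw [mem_cyl_iff] at hz ⊢
      exact hz)
    (by rw [hAp₁]; rfl)
    (by rw [hAp₂]; rfl)
    (by rw [Category.assoc, Category.assoc, hAp₁]; rfl)
  obtain ⟨ψ, hψ, hψφ⟩ := d.exists_extension (fst K J ≫ s) (fst K J ≫ α) L
    (fun m x hx ↦ Or.inr (Or.inl hx)) (fun m x hx ↦ Or.inr (Or.inr hx)) φ hφ
    (fun m x hx hx' ↦ by
      refine (hφ₃ m ⟨x, (mem_cyl_iff _ _).2 (Or.inr (Or.inl hx'))⟩ hx).trans ?_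
      exact congr_app_apply hAu₁
        ((⟨x.1.1, hx'⟩, x.2) : ((fiber s 0 : SSet.{u}) ⊗ Δ[1] : SSet.{u}).obj m))
  have hψ₁ : i₀ ▷ Δ[1] ≫ ψ = A₁ := by
    ext m x
    exact (congr_app_apply hψφ ⟨_, hm₁ m x⟩).trans (hφ₁ m x _)
  have hψ₂ : i₁ ▷ Δ[1] ≫ ψ = A₂ := by
    ext m x
    exact (congr_app_apply hψφ ⟨_, hm₂ m x⟩).trans (hφ₂ m x _)
  obtain ⟨β, hβ'⟩ := d.exists_eq_comp_h₁ ψ hψ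
  have e₁ : i₀ ≫ β = β₁ := d.eq_of_comp_h₁ (by
    rw [← hA₁₁, Category.assoc, ← hβ', ← ι₁_comp_assoc, hψ₁])
  have e₂ : i₁ ≫ β = β₂ := d.eq_of_comp_h₁ (by
    rw [← hA₂₁, Category.assoc, ← hβ', ← ι₁_comp_assoc, hψ₂])
  rw [← e₁, ← e₂]
  exact functorsEquivalent_of_coherentIso β

theorem mainTheorem3 {M C D : SSet.{u}} [Quasicategory C] [Quasicategory D]
    (p : M ⟶ Δ[1]) (hp : IsBicartesianFibration p)
    (f : C ⟶ D) (g : D ⟶ C) (d : AssociatedData p f g)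
    {K' K : SSet.{u}} (s : K ⟶ Δ[1]) (i : K' ⟶ K) (hi : Mono i) (hi₁ : IsIso (fiberMap i s 1))
    (α : K ⟶ C) (β' : K' ⟶ D) (h : IsAdjunct d (i ≫ s) (i ≫ α) β') :
    (∃ β : K ⟶ D, i ≫ β = β' ∧ IsAdjunct d s α β) ∧
    ∀ β₁ β₂ : K ⟶ D, i ≫ β₁ = β' → IsAdjunct d s α β₁ → i ≫ β₂ = β' → IsAdjunct d s α β₂ →
      FunctorsEquivalent β₁ β₂ := by
  have := hp.cocartesian.inner
  refine ⟨exists_isAdjunct_extension d s i hi₁ α β' h, fun β₁ β₂ e₁ h₁ e₂ h₂ ↦ ?_⟩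
  refine functorsEquivalent_of_isAdjunct d s α β₁ β₂ h₁ h₂ ?_
  ext m ⟨x, hx⟩
  obtain ⟨w, _, rfl⟩ := exists_mem_fiber_of_isIso s i 1 hi₁ x hx
  exact congr_app_apply (e₁.trans e₂.symm) w
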